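/- **Setting.** Consider a discrete-time Markov decision process with finite state space $S$, finite non-empty action set $A$, costs $c_i(a)\in\mathbb{R}$ and transition probabilities $p_{ij}(a)$. For a (possibly history-dependent, randomised) policy $\pi$ let $g_\pi(i)=\limsup_{n\to\infty}\frac1n E_\pi\big(\sum_{t=0}^{n-1}c_{X_t}(a_t)\,\big|\,X_0=i\big)$. A number $g^*$ is the optimal average cost if $g^*=\inf_\pi g_\pi(i)$ for every $i$, and a policy is average-cost optimal if it attains $\inf_\pi g_\pi(i)$ for every $i$. A map $d:S\to A$ is identified with the stationary deterministic policy that uses it at each time. The model is *recurrent*: for every $d:S\to A$ the transition matrix $(p_{ij}(d(i)))_{i,j}$ consists of a single recurrent class (is irreducible). Let $S$ be the node set of a tree with root $0$. For $i\neq0$ let $\rho(i)$ be the parent of $i$ (the node after $i$ on the path from $i$ to $0$); let $\mathcal T(i)$ be the subtree rooted at $i$ (all $j$ whose path to $0$ contains $i$), $\mathcal D(i)=\mathcal T(i)\setminus\{i\}$, and let $\Delta(0,j)$ be the set of nodes other than $0$ on the path from $0$ to $j$. The model is *skip-free (in the negative direction)* on this tree: $p_{ij}(a)>0$ implies $j\in\mathcal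 T(i)$, or $i\neq0$ and $j=\rho(i)$. Write $\bar p_{ik}(a)=\sum_{j\in\mathcal T(k)}p_{ij}(a)$. **Algorithm.** A *sweep* with value $x$ and non-empty allowed action sets $B_i\subseteq A$ computes, for the nodes $i\ne0$ from the leaves towards the root, $$a_i\in\operatorname*{argmin}_{a\in B_i}\frac{c_i(a)-x+\sum_{k\in\mathcal D(i)}\bar p_{ik}(a)y_k}{p_{i\rho(i)}(a)},$$ $$y_i=\frac{c_i(a_i)-x+\sum_{k\in\mathcal D(i)}\bar p_{ik}(a_i)y_k}{p_{i\rho(i)}(a_i)},\qquad t_i=\frac{1+\sum_{k\in\mathcal D(i)}\bar p_{ik}(a_i)t_k}{p_{i\rho(i)}(a_i)},$$ and then $$a_0\in\operatorname*{argmin}_{a\in B_0}\frac{c_0(a)-x+\sum_{k\in\mathcal D(0)}\bar p_{0k}(a)y_k}{1+\sum_{k\in\mathcal D(0)}\bar p_{0k}(a)t_k},\qquad u_0=\frac{c_0(a_0)-x+\sum_{k\in\mathcal D(0)}\bar p_{0k}(a_0)y_k}{1+\sum_{k\in\mathcal D(0)}\bar p_{0k}(a_0)t_k},$$ and (if $S\neq\{0\}$)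 $t_0=\big(1+\sum_{k\in\mathcal D(0)}\bar p_{0k}(a_0)t_k\big)/(1-p_{00}(a_0))$, which is not used elsewhere. Ties are broken arbitrarily. *Initialisation*: choose any $d_0:S\to A$, perform a sweep with $x=0$ and $B_i=\{d_0(i)\}$, and set $g_0=u_0$. *Iteration* $n+1$ ($n\ge0$): perform a sweep with $x=g_n$ and $B_i=A$ for all $i$; set $d_{n+1}(i)=a_i$ for $i\in S$ and $g_{n+1}=g_n+u_0$. If $u_0<0$, perform the next iteration; if $u_0=0$, stop. **Theorem.** The algorithm can be carried out from every initial $d_0$, and for every run of it: (i) At each iteration $n+1$ that is carried out, $g_n$ and $g_{n+1}$ are the average costs of $d_n$ and $d_{n+1}$ from every initial state, and either $g_{n+1}<g_n$, so that $d_{n+1}$ is a strict improvement on $d_n$, or $g_{n+1}=g_n$. In the latter case $g_{n+1}=g^*$ is the optimal average cost, $d_{n+1}$ is average-cost optimal, and the normalised relative costs, that is, the unique solution $h^*$ with $h^*_0=0$ of the optimality equations $$h_i=\min_{a\in A}\Big\{c_i(a)-g^*+\sum_{j\in S}p_{ij}(a)h_j\Big\},\qquad i\in S,$$ are given by $h^*_j=\sum_{i\in\Delta(0,j)}y_i$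 for $j\in S$, with the $y_i$ of that iteration. (ii) The algorithm stops, with $u_0=0$, after finitely many iterations. -/

import Mathlib

namespace SkipFreeMDP

/-- A discrete time Markov decision process with finite state space `S` and finite action set `A`:
immediate costs `c_i(a)` and transition probabilities `p_{ij}(a)`. -/
structure MDP (S A : Type*) [Fintype S] where
  /-- the immediate cost `c_i(a)` -/
  cost : S → A → ℝ
  /-- the transition probability `p_{ij}(a)`, written `prob i a j` -/
  prob : S → A → S → ℝ
  prob_nonneg : ∀ i a j, 0 ≤ prob i a j
  prob_sum : ∀ i a, ∑ j, prob i a j = 1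

/-- A tree (connected acyclic graph) on the node set `S` with a distinguished root. -/
structure RootedGraphTree (S : Type*) where
  /-- the edge set -/
  graph : SimpleGraph S
  isTree : graph.IsTree
  /-- the root node -/
  root : S

/-! ### Rooted trees -/

section Tree

variable {S : Type*} (T : RootedGraphTree S)

/-- The unique minimal path from `i` to `j` in the tree. -/
noncomputable def RootedGraphTree.path (i j : S) : T.graph.Walk i j :=
  (T.isTree.existsUnique_path i j).choose

/-- The parent `ρ(i)` of `i`: the second node on the path from `i` to the root
(the value at the root is the root itself). -/
noncomputable def RootedGraphTree.parent (i : S) : S :=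
  (T.path i T.root).getVert 1

open Classical in
/-- The set of nodes of the subtree rooted at `i`: all `j` such that the path from `j` to the root
contains `i` (in particular `i` itself). -/
noncomputable def RootedGraphTree.subtree [Fintype S] (i : S) : Finset S :=
  {j | i ∈ (T.path j T.root).support}

open Classical in
/-- The set of descendants of `i`: the subtree rooted at `i`, without `i`. -/
noncomputable def RootedGraphTree.descendants [Fintype S] (i : S) : Finset S :=
  {j | i ∈ (T.path j T.root).support ∧ j ≠ i}

open Classical in
/-- `Δ(i,j)`: the nodes following `i` on the path from `i` to `j`. -/
noncomputable def RootedGraphTree.pathAfter [Fintype S] (i j : S) : Finset S :=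
  {k | k ∈ (T.path i j).support ∧ k ≠ i}

end Tree

/-! ### Policies and average costs -/

/-- A history dependent randomised policy: at time `t`, given the states and actions
`(X_0,a_0),…,(X_{t-1},a_{t-1})` of the past and the current state `X_t = i`, the action `a` is
chosen with probability `rule t past i a`. -/
structure Policy (S A : Type*) [Fintype A] where
  /-- the probabilities with which actions are chosen -/
  rule : (t : ℕ) → (Fin t → S × A) → S → A → ℝ
  rule_nonneg : ∀ t past i a, 0 ≤ rule t past i a
  rule_sum : ∀ t past i, ∑ a, rule t past i a = 1

open Classical in
/-- The stationary deterministic policy which always uses the decision rule `d`. -/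
noncomputable def Policy.stationary {S A : Type*} [Fintype A] (d : S → A) : Policy S A where
  rule := fun _ _ i a => if a = d i then 1 else 0
  rule_nonneg := fun _ _ i a => by
    by_cases h : a = d i <;> simp [h]
  rule_sum := fun _ _ i => by simp

section Cost

variable {S A : Type*} [Fintype S] [Fintype A] (M : MDP S A)

open Classical in
/-- `M.histProb π i t past j` is the probability, under the policy `π` and given `X_0 = i`, that
`((X_0,a_0),…,(X_{t-1},a_{t-1})) = past` and `X_t = j`. -/
noncomputable def MDP.histProb (π : Policy S A) (i : S) : (t : ℕ) → (Fin t → S × A) → S → ℝ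
  | 0, _, j => if j = i then 1 else 0
  | t + 1, past, j =>
      MDP.histProb π i t (Fin.init past) (past (Fin.last t)).1
        * π.rule t (Fin.init past) (past (Fin.last t)).1 (past (Fin.last t)).2
        * M.prob (past (Fin.last t)).1 (past (Fin.last t)).2 j

open Classical in
/-- The expected cost `E_π (c_{X_t}(a_t) | X_0 = i)` incurred at time `t`. -/
noncomputable def MDP.expCost (π : Policy S A) (i : S) (t : ℕ) : ℝ :=
  ∑ past : Fin t → S × A, ∑ j : S, ∑ a : A,
    M.histProb π i t past j * π.rule t past j a * M.cost j a

/-- The expected average cost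
`g_π(i) = limsup_{n → ∞} (1/n) E_π (∑_{t=0}^{n-1} c_{X_t}(a_t) | X_0 = i)`. -/
noncomputable def MDP.avgCost (π : Policy S A) (i : S) : ℝ :=
  Filter.limsup (fun n : ℕ => (1 / (n : ℝ)) * ∑ t ∈ Finset.range n, M.expCost π i t) Filter.atTop

/-- `g` is the optimal average cost: for each initial state it is the infimum of the average costs
of all policies. -/
def MDP.IsOptimalCost (g : ℝ) : Prop :=
  ∀ i, IsGLB (Set.range fun π : Policy S A => M.avgCost π i) g

/-- The policy `π` is average cost optimal: for each initial state, no policy has a smaller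
average cost. -/
def MDP.IsOptimal (π : Policy S A) : Prop :=
  ∀ i, ∀ π' : Policy S A, M.avgCost π i ≤ M.avgCost π' i

/-- The average cost optimality equations
`h_i = min_a { c_i(a) - g + ∑_j p_{ij}(a) h_j }`, `i ∈ S`. -/
def MDP.SolvesOptimalityEq (g : ℝ) (h : S → ℝ) : Prop :=
  ∀ i, IsLeast (Set.range fun a : A => M.cost i a - g + ∑ j, M.prob i a j * h j) (h i)

/-- The model is recurrent: the transition matrix of every stationary deterministic policy
consists of a single recurrent class. -/
def MDP.IsRecurrent : Prop :=
  ∀ d : S → A, (Matrix.of fun i j => M.prob i (d i) j).IsIrreducible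

/-- The model is skip-free in the negative direction on the rooted tree `T`: from `i` the process
can only move to the parent of `i` or into the subtree rooted at `i`. -/
def MDP.IsSkipFree (T : RootedGraphTree S) : Prop :=
  ∀ i a j, M.prob i a j ≠ 0 → j = T.parent i ∨ j ∈ T.subtree i

/-- The tail probability `P(X_{t+1} ∈ T(k) | X_t = i, A_t = a)`. -/
noncomputable def MDP.tailProb (T : RootedGraphTree S) (i k : S) (a : A) : ℝ :=
  ∑ j ∈ T.subtree k, M.prob i a j

/-! ### The skip-free algorithm -/

/-- `a` is an `argmin` of `f` over the set `B` of actions. -/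
def IsArgmin (B : Set A) (f : A → ℝ) (a : A) : Prop :=
  a ∈ B ∧ ∀ b ∈ B, f a ≤ f b

/-- `M.IsSweep T B x d y t u` says that performing step 2 of the algorithm once, with the value `x`
and with the action in state `i` restricted to the set `B i`, can produce the actions `d i`, the
values `y i` (for `i` other than the root), `t i` and `u` (which stands for `u_0`). Ties in an
`argmin` may be broken in any way. For terminal nodes the sums over descendants are empty. -/
structure MDP.IsSweep (T : RootedGraphTree S) (B : S → Set A) (x : ℝ)
    (d : S → A) (y t : S → ℝ) (u : ℝ) : Prop where
  argmin : ∀ i, i ≠ T.root → IsArgmin (B i)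
    (fun a => (M.cost i a - x + ∑ k ∈ T.descendants i, M.tailProb T i k a * y k)
      / M.prob i a (T.parent i)) (d i)
  y_eq : ∀ i, i ≠ T.root →
    y i = (M.cost i (d i) - x + ∑ k ∈ T.descendants i, M.tailProb T i k (d i) * y k)
      / M.prob i (d i) (T.parent i)
  t_eq : ∀ i, i ≠ T.root →
    t i = (1 + ∑ k ∈ T.descendants i, M.tailProb T i k (d i) * t k)
      / M.prob i (d i) (T.parent i)
  argmin_root : IsArgmin (B T.root)
    (fun a => (M.cost T.root a - x
        + ∑ k ∈ T.descendants T.root, M.tailProb T T.root k a * y k)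
      / (1 + ∑ k ∈ T.descendants T.root, M.tailProb T T.root k a * t k)) (d T.root)
  u_eq : u = (M.cost T.root (d T.root) - x
        + ∑ k ∈ T.descendants T.root, M.tailProb T T.root k (d T.root) * y k)
      / (1 + ∑ k ∈ T.descendants T.root, M.tailProb T T.root k (d T.root) * t k)
  t_root : t T.root = (1 + ∑ k ∈ T.descendants T.root, M.tailProb T T.root k (d T.root) * t k)
      / (1 - M.prob T.root (d T.root) T.root)

/-- Iteration `n + 1`, which turns `(d n, g n)` into `(d (n+1), g (n+1))`, is carried out: each of
the iterations `1, …, n` ended with `u_0 < 0`, that is, with a return to step 2. -/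
def Performed (u : ℕ → ℝ) (n : ℕ) : Prop :=
  ∀ m, m < n → u (m + 1) < 0

/-- A run of the skip-free algorithm. Index `0` holds the output of the initialisation, and index
`n + 1` the output of iteration `n + 1` as long as this iteration is carried out; nothing is said
about later indices. -/
structure MDP.IsRun (T : RootedGraphTree S) (d : ℕ → S → A) (g u : ℕ → ℝ) (y t : ℕ → S → ℝ) :
    Prop where
  init : M.IsSweep T (fun i => {d 0 i}) 0 (d 0) (y 0) (t 0) (u 0)
  init_g : g 0 = u 0
  step : ∀ n, Performed u n →
    M.IsSweep T (fun _ => Set.univ) (g n) (d (n + 1)) (y (n + 1)) (t (n + 1)) (u (n + 1))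
  step_g : ∀ n, Performed u n → g (n + 1) = g n + u (n + 1)

end Cost

end SkipFreeMDP

/-! Let `h` be `potential y`, the sum of `y` along the path from the root. As steps go only to the
parent or into the subtree, the one-step expectation of `h` telescopes (`sum_prob_mul_potential`):
off the root, the recursion for `y` is exactly the optimality equation for `h` at value `x`, and the
recursion for `t` is the Poisson equation with unit costs. At the root, `u` is chosen so that
`potential y - u * potential t` solves the Poisson equation of the chosen rule with average cost `x
+ u` (`poisson`). Averaging Dynkin's formula then identifies `x + u` as the cost of that rule.

Let the previous rule `e` have a Poisson solution `H` with cost `x`. If `u > 0`, then `h - H` is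
subharmonic for `e`, strictly at the root, which contradicts the maximum principle (`value_nonpos`).
If `u = 0`, then `h` solves the optimality equations everywhere; Dynkin's formula bounds every
policy from below, and the maximum principle gives uniqueness up to constants. Strict descent cannot
go on for ever because there are finitely many decision rules. -/

namespace SkipFreeMDP

/-! ### Rooted trees and sums along paths from the root -/

namespace RootedGraphTree

variable {S : Type*} (T : RootedGraphTree S)

theorem path_isPath (i j : S) : (T.path i j).IsPath :=
  (T.isTree.existsUnique_path i j).choose_spec.1

theorem eq_path {i j : S} (p : T.graph.Walk i j) (hp : p.IsPath) : p = T.path i j :=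
  (T.isTree.existsUnique_path i j).choose_spec.2 p hp

theorem path_self (i : S) : T.path i i = .nil :=
  (T.eq_path _ .nil).symm

theorem path_reverse (i j : S) : (T.path i j).reverse = T.path j i :=
  T.eq_path _ (T.path_isPath i j).reverse

theorem support_eq_cons_support_path {i j : S} (hij : i ≠ j) (p : T.graph.Walk i j)
    (hp : p.IsPath) : p.support = i :: (T.path (p.getVert 1) j).support := by
  cases p with
  | nil => exact absurd rfl hij
  | cons h q =>
    have hq : q = T.path _ j := T.eq_path q ((SimpleGraph.Walk.cons_isPath_iff h q).1 hp).1
    rw [SimpleGraph.Walk.support_cons, SimpleGraph.Walk.getVert_cons_succ,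
      SimpleGraph.Walk.getVert_zero, ← hq]

theorem support_path_root {i : S} (hi : i ≠ T.root) :
    (T.path i T.root).support = i :: (T.path (T.parent i) T.root).support :=
  T.support_eq_cons_support_path hi _ (T.path_isPath i T.root)

/-- The number of nodes on the path from a node to the root. -/
noncomputable def depth (i : S) : ℕ := (T.path i T.root).support.length

theorem depth_parent {i : S} (hi : i ≠ T.root) : T.depth i = T.depth (T.parent i) + 1 := by
  rw [depth, T.support_path_root hi, List.length_cons, depth]

theorem induction_parent {P : S → Prop} (h_root : P T.root)
    (h_step : ∀ i, i ≠ T.root → P (T.parent i) → P i) (i : S) : P i := by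
  induction hn : T.depth i using Nat.strong_induction_on generalizing i with
  | _ n ih =>
    by_cases hi : i = T.root
    · exact hi ▸ h_root
    · exact h_step i hi (ih _ (by have := T.depth_parent hi; omega) _ rfl)

variable [Fintype S]

theorem mem_subtree {i j : S} : j ∈ T.subtree i ↔ i ∈ (T.path j T.root).support := by
  simp [subtree]

theorem mem_descendants {i j : S} : j ∈ T.descendants i ↔ j ∈ T.subtree i ∧ j ≠ i := by
  simp [descendants, subtree]

theorem mem_pathAfter_root {k j : S} :
    k ∈ T.pathAfter T.root j ↔ j ∈ T.subtree k ∧ k ≠ T.root := by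
  rw [mem_subtree, ← T.path_reverse T.root j]
  simp [pathAfter]

theorem root_mem_subtree {i : S} : T.root ∈ T.subtree i ↔ i = T.root := by
  rw [mem_subtree, path_self]
  simp

theorem mem_subtree_iff_parent {i j : S} (hj : j ≠ T.root) :
    j ∈ T.subtree i ↔ i = j ∨ T.parent j ∈ T.subtree i := by
  rw [mem_subtree, mem_subtree, T.support_path_root hj, List.mem_cons]

theorem self_mem_subtree (i : S) : i ∈ T.subtree i :=
  T.mem_subtree.2 (SimpleGraph.Walk.start_mem_support _)

theorem mem_subtree_root (i : S) : i ∈ T.subtree T.root :=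
  T.mem_subtree.2 (SimpleGraph.Walk.end_mem_support _)

theorem subtree_trans {i j k : S} (hk : k ∈ T.subtree i) (hj : j ∈ T.subtree k) :
    j ∈ T.subtree i := by
  induction j using T.induction_parent with
  | h_root => rwa [T.root_mem_subtree.1 hj] at hk
  | h_step j hne ih =>
    rcases (T.mem_subtree_iff_parent hne).1 hj with rfl | h
    · exact hk
    · exact (T.mem_subtree_iff_parent hne).2 (.inr (ih h))

theorem depth_lt_of_mem_descendants {i j : S} (hj : j ∈ T.descendants i) :
    T.depth i < T.depth j := by
  rw [mem_descendants] at hj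
  induction j using T.induction_parent with
  | h_root => exact absurd (T.root_mem_subtree.1 hj.1).symm hj.2
  | h_step j hne ih =>
    rw [T.depth_parent hne]
    rcases (T.mem_subtree_iff_parent hne).1 hj.1 with h | h
    · exact absurd h.symm hj.2
    · by_cases hp : T.parent j = i
      · rw [hp]; exact Nat.lt_succ_self _
      · exact Nat.lt_succ_of_lt (ih ⟨h, hp⟩)

/-- Depth increases strictly towards descendants and is bounded, as `S` is finite. This justifies
recursion from the leaves to the root. -/
theorem wellFounded_descendants : WellFounded fun k i => k ∈ T.descendants i := by
  obtain ⟨N, hN⟩ : ∃ N, ∀ i, T.depth i ≤ N :=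
    ⟨Finset.univ.sup T.depth, fun i => Finset.le_sup (Finset.mem_univ i)⟩
  refine Subrelation.wf (r := InvImage (· < ·) fun i => N - T.depth i) ?_
    (InvImage.wf _ wellFounded_lt)
  intro k i hk
  have := T.depth_lt_of_mem_descendants hk
  have := hN k
  simp only [InvImage]
  omega

theorem depth_le_of_mem_subtree {i j : S} (hj : j ∈ T.subtree i) : T.depth i ≤ T.depth j := by
  by_cases h : j = i
  · rw [h]
  · exact (T.depth_lt_of_mem_descendants (T.mem_descendants.2 ⟨hj, h⟩)).le

theorem parent_notMem_subtree {i : S} (hi : i ≠ T.root) : T.parent i ∉ T.subtree i := fun h => by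
  have := T.depth_le_of_mem_subtree h
  have := T.depth_parent hi
  omega

theorem ne_root_of_mem_descendants {i j : S} (hj : j ∈ T.descendants i) : j ≠ T.root := by
  rintro rfl
  rw [mem_descendants] at hj
  exact hj.2 (T.root_mem_subtree.1 hj.1).symm

/-- The sum of `y` over the nodes other than the root on the path from the root to `j`. -/
noncomputable def potential (y : S → ℝ) (j : S) : ℝ := ∑ k ∈ T.pathAfter T.root j, y k

theorem potential_root (y : S → ℝ) : T.potential y T.root = 0 := by
  refine Finset.sum_eq_zero fun k hk => ?_
  rw [mem_pathAfter_root, root_mem_subtree] at hk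
  exact absurd hk.1 hk.2

theorem potential_eq_add_parent (y : S → ℝ) {i : S} (hi : i ≠ T.root) :
    T.potential y i = y i + T.potential y (T.parent i) := by
  classical
  have h : T.pathAfter T.root i = insert i (T.pathAfter T.root (T.parent i)) := by
    ext k
    rw [Finset.mem_insert, mem_pathAfter_root, mem_pathAfter_root, T.mem_subtree_iff_parent hi]
    constructor
    · rintro ⟨rfl | h, h'⟩
      exacts [.inl rfl, .inr ⟨h, h'⟩]
    · rintro (rfl | ⟨h, h'⟩)
      exacts [⟨.inl rfl, hi⟩, ⟨.inr h, h'⟩]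
  rw [potential, h, Finset.sum_insert, potential]
  exact fun h => T.parent_notMem_subtree hi (T.mem_pathAfter_root.1 h).1

-- The path from the root to `j` passes through `i`; the nodes after `i` on it are the descendants
-- `k` of `i` whose subtree contains `j`.
open Classical in
theorem potential_of_mem_subtree (y : S → ℝ) {i j : S} (hj : j ∈ T.subtree i) :
    T.potential y j =
      T.potential y i + ∑ k ∈ T.descendants i, if j ∈ T.subtree k then y k else 0 := by
  have h_self : ∀ i, (∑ k ∈ T.descendants i, if i ∈ T.subtree k then y k else 0) = 0 := by
    refine fun i => Finset.sum_eq_zero fun k hk => if_neg fun h => ?_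
    have := T.depth_le_of_mem_subtree h
    have := T.depth_lt_of_mem_descendants hk
    omega
  induction j using T.induction_parent with
  | h_root => rw [T.root_mem_subtree.1 hj, h_self, add_zero]
  | h_step j hne ih =>
    by_cases hij : j = i
    · rw [hij, h_self, add_zero]
    have hp := ((T.mem_subtree_iff_parent hne).1 hj).resolve_left (Ne.symm hij)
    have h_split : ∀ k, (if j ∈ T.subtree k then y k else 0) =
        (if k = j then y k else 0) + if T.parent j ∈ T.subtree k then y k else 0 := by
      intro k
      simp only [T.mem_subtree_iff_parent hne]
      by_cases hk : k = j
      · subst hk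
        simp [T.parent_notMem_subtree hne]
      · simp [hk]
    simp_rw [h_split, Finset.sum_add_distrib, Finset.sum_ite_eq',
      if_pos (T.mem_descendants.2 ⟨hj, hij⟩)]
    rw [T.potential_eq_add_parent y hne, ih hp]
    ring

end RootedGraphTree

/-! ### Irreducibility, the maximum principle and one-step expectations of potentials -/

namespace MDP

variable {S A : Type*} [Fintype S] {M : MDP S A} {T : RootedGraphTree S}

/-- Irreducibility provides a path of positive-probability transitions from `i₀` to `j`, and `C`
propagates along it. -/
theorem IsRecurrent.forall_of_closed (hrec : M.IsRecurrent) (d : S → A) {C : S → Prop} {i₀ : S}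
    (h₀ : C i₀) (hC : ∀ i j, C i → M.prob i (d i) j ≠ 0 → C j) (j : S) : C j := by
  let P := Matrix.of fun i j => M.prob i (d i) j
  let _ : Quiver S := P.toQuiver
  have key : ∀ {j : S}, Quiver.Path i₀ j → C j := by
    intro j p
    induction p with
    | nil => exact h₀
    | cons q e ih => exact hC _ _ ih (ne_of_gt e.down)
  exact key ((hrec d).connected i₀ j).choose

/-- The maximum principle: a subharmonic function of an irreducible chain is constant. -/
theorem IsRecurrent.eq_of_subharmonic (hrec : M.IsRecurrent) (d : S → A) {w : S → ℝ}
    (hw : ∀ i, w i ≤ ∑ j, M.prob i (d i) j * w j) (i j : S) : w i = w j := by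
  have : Nonempty S := ⟨i⟩
  obtain ⟨m, hm⟩ := Finite.exists_max w
  have h_max : ∀ j, w j = w m := by
    refine hrec.forall_of_closed d (C := fun j => w j = w m) (i₀ := m) rfl ?_
    intro i j hi hij
    by_contra h_ne
    have h_lt : ∑ k, M.prob i (d i) k * w k < ∑ k, M.prob i (d i) k * w m := by
      refine Finset.sum_lt_sum
        (fun k _ => mul_le_mul_of_nonneg_left (hm k) (M.prob_nonneg i _ k))
        ⟨j, Finset.mem_univ j, ?_⟩
      exact mul_lt_mul_of_pos_left (lt_of_le_of_ne (hm j) h_ne)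
        (lt_of_le_of_ne (M.prob_nonneg _ _ _) hij.symm)
    rw [← Finset.sum_mul, M.prob_sum, one_mul, ← hi] at h_lt
    exact (hw i).not_gt h_lt
  rw [h_max i, h_max j]

theorem tailProb_nonneg (T : RootedGraphTree S) (i k : S) (a : A) : 0 ≤ M.tailProb T i k a :=
  Finset.sum_nonneg fun j _ => M.prob_nonneg i a j

/-- Otherwise the subtree of `i` would be closed under the constant rule `a`, although it misses the
root. -/
theorem prob_parent_pos (hrec : M.IsRecurrent) (hsf : M.IsSkipFree T) {i : S}
    (hi : i ≠ T.root) (a : A) : 0 < M.prob i a (T.parent i) := by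
  refine lt_of_le_of_ne (M.prob_nonneg _ _ _) fun h => hi ?_
  refine T.root_mem_subtree.1
    (hrec.forall_of_closed (fun _ => a) (C := (· ∈ T.subtree i)) (T.self_mem_subtree i) ?_ T.root)
  intro j k hj hjk
  rcases hsf j a k hjk with rfl | hk
  · have hij : i ≠ j := by
      rintro rfl
      exact hjk h.symm
    by_cases hjr : j = T.root
    · exact absurd (T.root_mem_subtree.1 (hjr ▸ hj)) hi
    · exact ((T.mem_subtree_iff_parent hjr).1 hj).resolve_left hij
  · exact T.subtree_trans hj hk

theorem sum_subtree_prob_mul_potential (i : S) (a : A) (y : S → ℝ) :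
    ∑ j ∈ T.subtree i, M.prob i a j * T.potential y j =
      (∑ j ∈ T.subtree i, M.prob i a j) * T.potential y i +
        ∑ k ∈ T.descendants i, M.tailProb T i k a * y k := by
  classical
  rw [Finset.sum_congr rfl fun j hj => by rw [T.potential_of_mem_subtree y hj]]
  simp_rw [mul_add, Finset.sum_add_distrib, Finset.sum_mul, Finset.mul_sum]
  rw [Finset.sum_comm]
  congr 1
  refine Finset.sum_congr rfl fun k hk => ?_
  have h_sub : T.subtree k ⊆ T.subtree i := fun j hj =>
    T.subtree_trans (T.mem_descendants.1 hk).1 hj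
  rw [tailProb, Finset.sum_mul, ← Finset.sum_subset h_sub]
  · exact Finset.sum_congr rfl fun j hj => by rw [if_pos hj]
  · intro j _ hj
    rw [if_neg hj, mul_zero]

theorem sum_prob_root_mul_potential (a : A) (y : S → ℝ) :
    ∑ j, M.prob T.root a j * T.potential y j =
      ∑ k ∈ T.descendants T.root, M.tailProb T T.root k a * y k := by
  have h := sum_subtree_prob_mul_potential (M := M) (T := T) T.root a y
  rw [T.potential_root, mul_zero, zero_add] at h
  rw [← h, Finset.eq_univ_of_forall T.mem_subtree_root]

/-- The mass of `p_i` splits between the parent, where the potential is lower by `y i`, and the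
subtree, where the increments over `i` regroup into tail probabilities. -/
theorem sum_prob_mul_potential (hsf : M.IsSkipFree T) {i : S} (hi : i ≠ T.root) (a : A)
    (y : S → ℝ) :
    ∑ j, M.prob i a j * T.potential y j =
      T.potential y i - M.prob i a (T.parent i) * y i +
        ∑ k ∈ T.descendants i, M.tailProb T i k a * y k := by
  classical
  have h_sum : ∀ f : S → ℝ, ∑ j, M.prob i a j * f j =
      M.prob i a (T.parent i) * f (T.parent i) + ∑ j ∈ T.subtree i, M.prob i a j * f j := by
    intro f
    rw [← Finset.sum_insert (f := fun j => M.prob i a j * f j) (T.parent_notMem_subtree hi)]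
    refine (Finset.sum_subset (Finset.subset_univ _) fun j _ hj => ?_).symm
    by_contra h
    exact hj (Finset.mem_insert.2 (hsf i a j (left_ne_zero_of_mul h)))
  have h_one := h_sum fun _ => 1
  simp only [mul_one, M.prob_sum] at h_one
  rw [h_sum, sum_subtree_prob_mul_potential]
  have h_parent := T.potential_eq_add_parent y hi
  linear_combination (-T.potential y i) * h_one - M.prob i a (T.parent i) * h_parent

/-! ### What a sweep computes -/

namespace IsSweep

variable {B : S → Set A} {x : ℝ} {d : S → A} {y t : S → ℝ} {u : ℝ}

theorem t_pos (h : M.IsSweep T B x d y t u) (hrec : M.IsRecurrent) (hsf : M.IsSkipFree T)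
    {i : S} (hi : i ≠ T.root) : 0 < t i := by
  induction i using T.wellFounded_descendants.induction with
  | _ i ih =>
    rw [h.t_eq i hi]
    exact div_pos (add_pos_of_pos_of_nonneg one_pos
      (Finset.sum_nonneg fun k hk => mul_nonneg (tailProb_nonneg T i k _)
        (ih k hk (T.ne_root_of_mem_descendants hk)).le))
      (prob_parent_pos hrec hsf hi _)

theorem potential_le (h : M.IsSweep T B x d y t u) (hrec : M.IsRecurrent) (hsf : M.IsSkipFree T)
    {i : S} (hi : i ≠ T.root) {a : A} (ha : a ∈ B i) :
    T.potential y i ≤ M.cost i a - x + ∑ j, M.prob i a j * T.potential y j := by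
  have h_le := (h.argmin i hi).2 a ha
  simp only at h_le
  rw [← h.y_eq i hi, le_div_iff₀ (prob_parent_pos hrec hsf hi a)] at h_le
  rw [sum_prob_mul_potential hsf hi]
  linarith

theorem potential_eq (h : M.IsSweep T B x d y t u) (hrec : M.IsRecurrent) (hsf : M.IsSkipFree T)
    {i : S} (hi : i ≠ T.root) :
    T.potential y i = M.cost i (d i) - x + ∑ j, M.prob i (d i) j * T.potential y j := by
  have h_eq := h.y_eq i hi
  rw [eq_div_iff (prob_parent_pos hrec hsf hi _).ne'] at h_eq
  rw [sum_prob_mul_potential hsf hi]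
  linarith

theorem potential_t_eq (h : M.IsSweep T B x d y t u) (hrec : M.IsRecurrent)
    (hsf : M.IsSkipFree T) {i : S} (hi : i ≠ T.root) :
    T.potential t i = 1 + ∑ j, M.prob i (d i) j * T.potential t j := by
  have h_eq := h.t_eq i hi
  rw [eq_div_iff (prob_parent_pos hrec hsf hi _).ne'] at h_eq
  rw [sum_prob_mul_potential hsf hi]
  linarith

theorem cycle_length_pos (h : M.IsSweep T B x d y t u) (hrec : M.IsRecurrent)
    (hsf : M.IsSkipFree T) (a : A) :
    0 < 1 + ∑ k ∈ T.descendants T.root, M.tailProb T T.root k a * t k :=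
  add_pos_of_pos_of_nonneg one_pos (Finset.sum_nonneg fun k hk =>
    mul_nonneg (tailProb_nonneg T _ k _)
      (h.t_pos hrec hsf (T.ne_root_of_mem_descendants hk)).le)

/-- The function `potential y - u • potential t` solves the Poisson equation of the decision rule
chosen by the sweep, with average cost `x + u`. -/
theorem poisson (h : M.IsSweep T B x d y t u) (hrec : M.IsRecurrent) (hsf : M.IsSkipFree T)
    (i : S) :
    T.potential y i - u * T.potential t i = M.cost i (d i) - (x + u) +
      ∑ j, M.prob i (d i) j * (T.potential y j - u * T.potential t j) := by
  simp_rw [mul_sub, Finset.sum_sub_distrib, mul_left_comm _ u, ← Finset.mul_sum]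
  by_cases hi : i = T.root
  · subst hi
    have hu := h.u_eq
    rw [eq_div_iff (h.cycle_length_pos hrec hsf _).ne'] at hu
    rw [T.potential_root, T.potential_root, sum_prob_root_mul_potential,
      sum_prob_root_mul_potential]
    linarith
  · linear_combination h.potential_eq hrec hsf hi - u * h.potential_t_eq hrec hsf hi

/-- A solution of the Poisson equation with average cost `x` bounds the value of a sweep. -/
theorem value_nonpos (h : M.IsSweep T (fun _ => Set.univ) x d y t u) (hrec : M.IsRecurrent)
    (hsf : M.IsSkipFree T) {e : S → A} {H : S → ℝ}
    (hH : ∀ i, H i = M.cost i (e i) - x + ∑ j, M.prob i (e i) j * H j) : u ≤ 0 := by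
  by_contra! hu
  have h_pos : 0 < M.cost T.root (e T.root) - x +
      ∑ j, M.prob T.root (e T.root) j * T.potential y j := by
    -- The action of `e` competes in the argmin at the root, so its quotient is at least `u > 0`;
    -- the denominator is positive.
    have h_le := h.argmin_root.2 (e T.root) trivial
    simp only at h_le
    rw [← h.u_eq] at h_le
    rw [sum_prob_root_mul_potential]
    exact (div_pos_iff_of_pos_right (h.cycle_length_pos hrec hsf _)).1 (hu.trans_le h_le)
  have h_sub : ∀ i, T.potential y i - H i ≤
      ∑ j, M.prob i (e i) j * (T.potential y j - H j) := by
    intro i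
    simp_rw [mul_sub, Finset.sum_sub_distrib]
    have h_eq := hH i
    by_cases hi : i = T.root
    · subst hi
      rw [T.potential_root]
      linarith
    · have := h.potential_le hrec hsf hi (Set.mem_univ (e i))
      linarith
  -- A constant difference makes the inequality at the root an equality, against the strictness of
  -- `h_pos`.
  have h_const := hrec.eq_of_subharmonic e h_sub
  have h_root := hH T.root
  have h_sum : ∑ j, M.prob T.root (e T.root) j * (T.potential y j - H j) = -H T.root := by
    simp_rw [h_const _ T.root, ← Finset.sum_mul, M.prob_sum, T.potential_root]
    ring
  simp_rw [mul_sub, Finset.sum_sub_distrib] at h_sum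
  linarith

/-- With `u = 0` the least quotient at the root is zero, so, the denominators being positive, the
least numerator is zero too. -/
theorem solvesOptimalityEq (h : M.IsSweep T (fun _ => Set.univ) x d y t 0)
    (hrec : M.IsRecurrent) (hsf : M.IsSkipFree T) : M.SolvesOptimalityEq x (T.potential y) := by
  intro i
  refine ⟨⟨d i, ?_⟩, ?_⟩
  · have := h.poisson hrec hsf i
    simp only [zero_mul, sub_zero, add_zero] at this
    exact this.symm
  · rintro _ ⟨a, rfl⟩
    by_cases hi : i = T.root
    · subst hi
      have h_le := h.argmin_root.2 a trivial
      simp only at h_le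
      rw [← h.u_eq, le_div_iff₀ (h.cycle_length_pos hrec hsf _), zero_mul] at h_le
      simp only [sum_prob_root_mul_potential, T.potential_root]
      exact h_le
    · exact h.potential_le hrec hsf hi (Set.mem_univ a)

end IsSweep

/-- A rule attaining the minimum for `h'` makes `h - h'` subharmonic. -/
theorem SolvesOptimalityEq.sub_eq_sub (hrec : M.IsRecurrent) {g : ℝ} {h h' : S → ℝ}
    (hh : M.SolvesOptimalityEq g h) (hh' : M.SolvesOptimalityEq g h') (i j : S) :
    h i - h' i = h j - h' j := by
  choose e he using fun i => (hh' i).1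
  refine hrec.eq_of_subharmonic e (w := fun i => h i - h' i) (fun i => ?_) i j
  have h_le := (hh i).2 ⟨e i, rfl⟩
  have h_eq := he i
  simp only at h_le h_eq
  simp_rw [mul_sub, Finset.sum_sub_distrib]
  linarith

/-- Sweeps exist, since the values at a node are determined by those at its descendants. -/
theorem exists_isSweep [Finite A] (M : MDP S A) (T : RootedGraphTree S) {B : S → Set A}
    (hB : ∀ i, (B i).Nonempty) (x : ℝ) : ∃ d y t u, M.IsSweep T B x d y t u := by
  classical
  have h_min : ∀ i (f : A → ℝ), ∃ a, IsArgmin (B i) f a := fun i f => by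
    obtain ⟨a, ha, h⟩ := Set.exists_min_image (B i) f (Set.toFinite _) (hB i)
    exact ⟨a, ha, h⟩
  choose sel h_sel using h_min
  let r : S → S → Prop := fun k i => k ∈ T.descendants i
  have hr : WellFounded r := T.wellFounded_descendants
  let s : (S → ℝ) → S → A → ℝ := fun z i a => ∑ k ∈ T.descendants i, M.tailProb T i k a * z k
  let y : S → ℝ := hr.fix fun i rec =>
    let z : S → ℝ := fun k => if hk : r k i then rec k hk else 0
    let f : A → ℝ := fun a => (M.cost i a - x + s z i a) / M.prob i a (T.parent i)
    f (sel i f)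
  let f : S → A → ℝ := fun i a => (M.cost i a - x + s y i a) / M.prob i a (T.parent i)
  -- The recursion sees `y` only at descendants; extending it by zero elsewhere does not affect the
  -- sums.
  have hs : ∀ (y : S → ℝ) i, s (fun k => if _ : r k i then y k else 0) i = s y i := by
    intro y i
    funext a
    refine Finset.sum_congr rfl fun k hk => ?_
    exact congrArg _ (dif_pos hk)
  have hy : ∀ i, y i = f i (sel i (f i)) := fun i => by
    have := hr.fix_eq (C := fun _ => ℝ) (fun i rec =>
      let z : S → ℝ := fun k => if hk : r k i then rec k hk else 0
      let f : A → ℝ := fun a => (M.cost i a - x + s z i a) / M.prob i a (T.parent i)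
      f (sel i f)) i
    simp only [hs] at this
    exact this
  let t' : S → ℝ := hr.fix fun i rec =>
    let z : S → ℝ := fun k => if hk : r k i then rec k hk else 0
    (1 + s z i (sel i (f i))) / M.prob i (sel i (f i)) (T.parent i)
  have ht' : ∀ i, t' i = (1 + s t' i (sel i (f i))) / M.prob i (sel i (f i)) (T.parent i) :=
      fun i => by
    have := hr.fix_eq (C := fun _ => ℝ) (fun i rec =>
      let z : S → ℝ := fun k => if hk : r k i then rec k hk else 0
      (1 + s z i (sel i (f i))) / M.prob i (sel i (f i)) (T.parent i)) i
    simp only [hs] at this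
    exact this
  let q : A → ℝ := fun a => (M.cost T.root a - x + s y T.root a) / (1 + s t' T.root a)
  let a₀ : A := sel T.root q
  -- The recursion also yields values at the root, where the parent is a default. Those of `d` and
  -- `t` are overwritten, and a sweep does not constrain `y` there.
  let d : S → A := Function.update (fun i => sel i (f i)) T.root a₀
  let t : S → ℝ := Function.update t' T.root ((1 + s t' T.root a₀) / (1 - M.prob T.root a₀ T.root))
  have hst : ∀ i, s t i = s t' i := fun i => by
    funext a
    refine Finset.sum_congr rfl fun k hk => ?_
    exact congrArg _ (Function.update_of_ne (T.ne_root_of_mem_descendants hk) _ _)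
  have hd : ∀ i, i ≠ T.root → d i = sel i (f i) := fun i hi => Function.update_of_ne hi _ _
  have hd₀ : d T.root = a₀ := Function.update_self ..
  have hst₀ : ∀ a, ∑ k ∈ T.descendants T.root, M.tailProb T T.root k a * t k = s t' T.root a :=
    fun a => congrFun (hst T.root) a
  refine ⟨d, y, t, q a₀, ?_, ?_, ?_, ?_, ?_, ?_⟩
  · intro i hi
    rw [hd i hi]
    exact h_sel i (f i)
  · intro i hi
    rw [hd i hi]
    exact hy i
  · intro i hi
    rw [hd i hi]
    change t i = (1 + s t i _) / _
    rw [hst, ← ht' i]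
    exact Function.update_of_ne hi _ _
  · simp only [hst₀, hd₀]
    exact h_sel T.root q
  · simp only [hst₀, hd₀]
    rfl
  · simp only [hst₀, hd₀]
    exact Function.update_self ..

end MDP

/-! ### Dynkin's formula and average costs of policies -/

namespace MDP

variable {S A : Type*} [Fintype S] [Fintype A] (M : MDP S A)

theorem histProb_nonneg (π : Policy S A) (i : S) :
    ∀ (t : ℕ) (past : Fin t → S × A) (j : S), 0 ≤ M.histProb π i t past j
  | 0, past, j => by
    rw [histProb]
    split_ifs
    exacts [zero_le_one, le_rfl]
  | t + 1, past, j => by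
    rw [histProb]
    exact mul_nonneg (mul_nonneg (histProb_nonneg π i t _ _) (π.rule_nonneg _ _ _ _))
      (M.prob_nonneg _ _ _)

/-- The expectation `E_π (f (X_t) | X_0 = i)`. -/
noncomputable def expState (π : Policy S A) (i : S) (f : S → ℝ) (t : ℕ) : ℝ :=
  ∑ past : Fin t → S × A, ∑ j, M.histProb π i t past j * f j

theorem expState_zero (π : Policy S A) (i : S) (f : S → ℝ) : M.expState π i f 0 = f i := by
  classical
  simp [expState, histProb]

/-- Conditioning on the last state and action: histories of length `t + 1` are split into their
first `t` entries and the last one. -/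
theorem expState_succ (π : Policy S A) (i : S) (f : S → ℝ) (t : ℕ) :
    M.expState π i f (t + 1) = ∑ past : Fin t → S × A, ∑ j, ∑ a,
      M.histProb π i t past j * π.rule t past j a * ∑ k, M.prob j a k * f k := by
  rw [expState, ← (Fin.snocEquiv fun _ : Fin (t + 1) => S × A).sum_comp, Fintype.sum_prod_type,
    Finset.sum_comm]
  refine Finset.sum_congr rfl fun past _ => ?_
  rw [Fintype.sum_prod_type]
  refine Finset.sum_congr rfl fun j _ => Finset.sum_congr rfl fun a _ => ?_
  rw [Finset.mul_sum]
  refine Finset.sum_congr rfl fun k _ => ?_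
  simp only [Fin.snocEquiv, Equiv.coe_fn_mk, histProb, Fin.init_snoc, Fin.snoc_last, mul_assoc]

theorem expState_const (π : Policy S A) (i : S) (r : ℝ) (t : ℕ) :
    M.expState π i (fun _ => r) t = r := by
  induction t with
  | zero => exact M.expState_zero π i _
  | succ t ih =>
    refine Eq.trans ?_ ih
    rw [expState_succ, expState]
    refine Finset.sum_congr rfl fun past _ => Finset.sum_congr rfl fun j _ => ?_
    simp_rw [← Finset.sum_mul, M.prob_sum, one_mul]
    rw [← Finset.sum_mul, ← Finset.mul_sum, π.rule_sum, mul_one]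

theorem expState_mono (π : Policy S A) (i : S) {f f' : S → ℝ} (hf : ∀ j, f j ≤ f' j) (t : ℕ) :
    M.expState π i f t ≤ M.expState π i f' t :=
  Finset.sum_le_sum fun past _ => Finset.sum_le_sum fun j _ =>
    mul_le_mul_of_nonneg_left (hf j) (M.histProb_nonneg π i t past j)

theorem abs_expState_le (π : Policy S A) (i : S) {f : S → ℝ} {K : ℝ} (hf : ∀ j, |f j| ≤ K)
    (t : ℕ) : |M.expState π i f t| ≤ K := by
  refine abs_le.2 ⟨?_, ?_⟩
  · rw [← M.expState_const π i (-K) t]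
    exact M.expState_mono π i (fun j => (abs_le.1 (hf j)).1) t
  · rw [← M.expState_const π i K t]
    exact M.expState_mono π i (fun j => (abs_le.1 (hf j)).2) t

/-- Dynkin's formula over one step. -/
theorem expCost_eq_sum (π : Policy S A) (i : S) (g : ℝ) (h : S → ℝ) (t : ℕ) :
    M.expCost π i t - g + M.expState π i h (t + 1) - M.expState π i h t =
      ∑ past : Fin t → S × A, ∑ j, ∑ a, M.histProb π i t past j * π.rule t past j a *
        (M.cost j a - g + ∑ k, M.prob j a k * h k - h j) := by
  have h_action : ∀ f : S → ℝ, M.expState π i f t =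
      ∑ past : Fin t → S × A, ∑ j, ∑ a, M.histProb π i t past j * π.rule t past j a * f j := by
    intro f
    refine Finset.sum_congr rfl fun past _ => Finset.sum_congr rfl fun j _ => ?_
    rw [← Finset.sum_mul, ← Finset.mul_sum, π.rule_sum, mul_one]
  have h_g := M.expState_const π i g t
  rw [h_action] at h_g
  rw [h_action, expState_succ, expCost]
  conv_lhs => rw [← h_g]
  simp_rw [← Finset.sum_sub_distrib, ← Finset.sum_add_distrib, ← Finset.sum_sub_distrib]
  refine Finset.sum_congr rfl fun past _ => Finset.sum_congr rfl fun j _ =>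
    Finset.sum_congr rfl fun a _ => ?_
  ring

/-- Every summand in Dynkin's formula is nonnegative, and the terms in `h` telescope over time. -/
theorem le_sum_expCost (π : Policy S A) (i : S) {g : ℝ} {h : S → ℝ}
    (hh : ∀ j a, h j ≤ M.cost j a - g + ∑ k, M.prob j a k * h k) (n : ℕ) :
    n * g + h i - M.expState π i h n ≤ ∑ t ∈ Finset.range n, M.expCost π i t := by
  induction n with
  | zero => simp [expState_zero]
  | succ n ih =>
    have h_nonneg : 0 ≤ M.expCost π i n - g + M.expState π i h (n + 1) - M.expState π i h n := by
      rw [expCost_eq_sum]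
      exact Finset.sum_nonneg fun past _ => Finset.sum_nonneg fun j _ =>
        Finset.sum_nonneg fun a _ => mul_nonneg
          (mul_nonneg (M.histProb_nonneg π i n past j) (π.rule_nonneg n past j a))
          (sub_nonneg.2 (hh j a))
    rw [Finset.sum_range_succ]
    push_cast
    linarith

theorem sum_expCost_stationary (d : S → A) (i : S) {g : ℝ} {h : S → ℝ}
    (hh : ∀ j, h j = M.cost j (d j) - g + ∑ k, M.prob j (d j) k * h k) (n : ℕ) :
    ∑ t ∈ Finset.range n, M.expCost (.stationary d) i t =
      n * g + h i - M.expState (.stationary d) i h n := by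
  induction n with
  | zero => simp [expState_zero]
  | succ n ih =>
    have h_zero : M.expCost (.stationary d) i n - g + M.expState (.stationary d) i h (n + 1) -
        M.expState (.stationary d) i h n = 0 := by
      rw [expCost_eq_sum]
      refine Finset.sum_eq_zero fun past _ => Finset.sum_eq_zero fun j _ =>
        Finset.sum_eq_zero fun a _ => ?_
      by_cases ha : a = d j
      · rw [ha, ← hh j, sub_self, mul_zero]
      · simp [Policy.stationary, ha]
    rw [Finset.sum_range_succ, ih]
    push_cast
    linarith

theorem expCost_le (π : Policy S A) (i : S) {K : ℝ} (hK : ∀ j a, M.cost j a ≤ K) (t : ℕ) :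
    M.expCost π i t ≤ K := by
  -- Dynkin's formula with `h = 0` reduces the bound to the sign of `M.cost j a - K`.
  have h := M.expCost_eq_sum π i K (fun _ => 0) t
  rw [expState_const, expState_const] at h
  have : M.expCost π i t - K + 0 - 0 ≤ 0 := by
    rw [h]
    refine Finset.sum_nonpos fun past _ => Finset.sum_nonpos fun j _ =>
      Finset.sum_nonpos fun a _ => mul_nonpos_of_nonneg_of_nonpos
        (mul_nonneg (M.histProb_nonneg π i t past j) (π.rule_nonneg t past j a)) ?_
    simpa using hK j a
  linarith

open Filter Topology in
theorem tendsto_average_of_bounded {g K : ℝ} {e : ℕ → ℝ} (he : ∀ n, |e n| ≤ K) :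
    Tendsto (fun n : ℕ => (1 / (n : ℝ)) * (n * g + e n)) atTop (𝓝 g) := by
  have h_zero : Tendsto (fun n : ℕ => (1 / (n : ℝ)) * e n) atTop (𝓝 0) := by
    refine squeeze_zero_norm (a := fun n : ℕ => K / n) (fun n => ?_)
      (tendsto_const_div_atTop_nhds_zero_nat K)
    rw [norm_mul, Real.norm_eq_abs, Real.norm_eq_abs, abs_of_nonneg (by positivity),
      one_div_mul_eq_div]
    exact div_le_div_of_nonneg_right (he n) n.cast_nonneg
  have h_add := h_zero.const_add g
  rw [add_zero] at h_add
  refine h_add.congr' ?_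
  filter_upwards [eventually_gt_atTop 0] with n hn
  have : (n : ℝ) ≠ 0 := by positivity
  field_simp

theorem abs_sub_expState_le (π : Policy S A) (i : S) (h : S → ℝ) :
    ∃ K, ∀ n, |h i - M.expState π i h n| ≤ K := by
  have hK : ∀ j, |h j| ≤ ∑ k, |h k| := fun j =>
    Finset.single_le_sum (f := fun k => |h k|) (fun k _ => abs_nonneg _) (Finset.mem_univ j)
  exact ⟨_, fun n => (abs_sub _ _).trans (add_le_add (hK i) (M.abs_expState_le π i hK n))⟩

/-- A solution of the Poisson equation of a decision rule gives its average cost. -/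
theorem avgCost_stationary (d : S → A) {g : ℝ} {h : S → ℝ}
    (hh : ∀ j, h j = M.cost j (d j) - g + ∑ k, M.prob j (d j) k * h k) (i : S) :
    M.avgCost (.stationary d) i = g := by
  obtain ⟨K, hK⟩ := M.abs_sub_expState_le (.stationary d) i h
  simp_rw [avgCost, M.sum_expCost_stationary d i hh, add_sub_assoc]
  exact (tendsto_average_of_bounded hK).limsup_eq

theorem le_avgCost (π : Policy S A) {g : ℝ} {h : S → ℝ}
    (hh : ∀ j a, h j ≤ M.cost j a - g + ∑ k, M.prob j a k * h k) (i : S) :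
    g ≤ M.avgCost π i := by
  obtain ⟨K, hK⟩ := M.abs_sub_expState_le π i h
  obtain ⟨C, hC⟩ : ∃ C, ∀ j a, M.cost j a ≤ C := by
    obtain ⟨C, hC⟩ := (Set.finite_range fun p : S × A => M.cost p.1 p.2).bddAbove
    exact ⟨C, fun j a => hC ⟨(j, a), rfl⟩⟩
  have h_lim := tendsto_average_of_bounded (g := g) hK
  rw [← h_lim.limsup_eq, avgCost]
  -- Comparing limsups in `ℝ` requires the averages to be bounded above. The bound `max C 0` also
  -- covers `n = 0`, where the average is `0`.
  refine Filter.limsup_le_limsup (.of_forall fun n => ?_) h_lim.isCoboundedUnder_le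
    (Filter.isBoundedUnder_of ⟨max C 0, fun n => ?_⟩)
  · refine mul_le_mul_of_nonneg_left ?_ (by positivity)
    rw [← add_sub_assoc]
    exact M.le_sum_expCost π i hh n
  · have h_sum : ∑ t ∈ Finset.range n, M.expCost π i t ≤ n * C := by
      simpa using Finset.sum_le_card_nsmul (Finset.range n) _ C
        fun t _ => M.expCost_le π i hC t
    rcases n.eq_zero_or_pos with rfl | hn
    · simp
    · refine le_max_of_le_left ?_
      rwa [one_div_mul_eq_div, div_le_iff₀ (by positivity), mul_comm]

end MDP

/-! ### Runs of the algorithm: monotonicity and termination -/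

namespace MDP

variable {S A : Type*} [Fintype S] {M : MDP S A} {T : RootedGraphTree S}

namespace IsRun

variable {d : ℕ → S → A} {g u : ℕ → ℝ} {y t : ℕ → S → ℝ}

/-- Treats the initialisation and the later iterations alike: in both cases `d n` comes from a
sweep, so `poisson` applies to it with average cost `g n`. -/
theorem exists_isSweep (h : M.IsRun T d g u y t) {n : ℕ} (hn : Performed u n) :
    ∃ B x, M.IsSweep T B x (d n) (y n) (t n) (u n) ∧ g n = x + u n := by
  cases n with
  | zero => exact ⟨_, _, h.init, by rw [h.init_g, zero_add]⟩
  | succ n =>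
    have hn' : Performed u n := fun m hm => hn m (Nat.lt_succ_of_lt hm)
    exact ⟨_, _, h.step n hn', h.step_g n hn'⟩

theorem value_nonpos (h : M.IsRun T d g u y t) (hrec : M.IsRecurrent) (hsf : M.IsSkipFree T)
    {n : ℕ} (hn : Performed u n) : u (n + 1) ≤ 0 := by
  obtain ⟨B, x, hs, hg⟩ := h.exists_isSweep hn
  have h_poisson := hs.poisson hrec hsf
  simp_rw [← hg] at h_poisson
  exact (h.step n hn).value_nonpos hrec hsf h_poisson

end IsRun

variable [Fintype A]

theorem IsSweep.avgCost_eq {B : S → Set A} {x : ℝ} {d : S → A} {y t : S → ℝ} {u : ℝ}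
    (h : M.IsSweep T B x d y t u) (hrec : M.IsRecurrent) (hsf : M.IsSkipFree T) (i : S) :
    M.avgCost (.stationary d) i = x + u :=
  M.avgCost_stationary d (h.poisson hrec hsf) i

theorem SolvesOptimalityEq.le_avgCost {g : ℝ} {h : S → ℝ} (hh : M.SolvesOptimalityEq g h)
    (π : Policy S A) (i : S) : g ≤ M.avgCost π i :=
  M.le_avgCost π (fun j a => (hh j).2 ⟨a, rfl⟩) i

/-- The algorithm can be carried out from every initial decision rule. -/
theorem exists_isRun [Nonempty A] (M : MDP S A) (T : RootedGraphTree S) (d₀ : S → A) :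
    ∃ (d : ℕ → S → A) (g u : ℕ → ℝ) (y t : ℕ → S → ℝ), d 0 = d₀ ∧ M.IsRun T d g u y t := by
  obtain ⟨d₁, y₀, t₀, u₀, h₀⟩ :=
    M.exists_isSweep T (B := fun i => {d₀ i}) (fun i => Set.singleton_nonempty _) 0
  have h_eq : d₁ = d₀ := by
    funext i
    by_cases hi : i = T.root
    · exact hi ▸ h₀.argmin_root.1
    · exact (h₀.argmin i hi).1
  subst h_eq
  choose sd sy st su h_step using fun x =>
    M.exists_isSweep T (B := fun _ => Set.univ) (fun _ => Set.univ_nonempty) x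
  -- The iteration is continued past the stopping time, since `IsRun` leaves later indices free.
  let g : ℕ → ℝ := Nat.rec u₀ fun _ x => x + su x
  refine ⟨fun n => n.casesOn d₁ fun n => sd (g n), g, fun n => n.casesOn u₀ fun n => su (g n),
    fun n => n.casesOn y₀ fun n => sy (g n), fun n => n.casesOn t₀ fun n => st (g n), rfl, ?_⟩
  exact ⟨h₀, rfl, fun n _ => h_step (g n), fun n _ => rfl⟩

namespace IsRun

variable {d : ℕ → S → A} {g u : ℕ → ℝ} {y t : ℕ → S → ℝ}

theorem avgCost_eq (h : M.IsRun T d g u y t) (hrec : M.IsRecurrent) (hsf : M.IsSkipFree T)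
    {n : ℕ} (hn : Performed u n) (i : S) : M.avgCost (.stationary (d n)) i = g n := by
  obtain ⟨B, x, hs, hg⟩ := h.exists_isSweep hn
  rw [hg, hs.avgCost_eq hrec hsf]

theorem avgCost_succ_eq (h : M.IsRun T d g u y t) (hrec : M.IsRecurrent) (hsf : M.IsSkipFree T)
    {n : ℕ} (hn : Performed u n) (i : S) :
    M.avgCost (.stationary (d (n + 1))) i = g (n + 1) := by
  rw [h.step_g n hn, (h.step n hn).avgCost_eq hrec hsf]

theorem exists_value_eq_zero (h : M.IsRun T d g u y t) (hrec : M.IsRecurrent) (hsf : M.IsSkipFree T) :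
    ∃ n, Performed u n ∧ u (n + 1) = 0 := by
  by_contra! h_never
  have h_all : ∀ n, Performed u n := by
    intro n
    induction n with
    | zero => exact fun m hm => absurd hm m.not_lt_zero
    | succ n ih =>
      intro m hm
      rcases Nat.lt_succ_iff_lt_or_eq.1 hm with hm | rfl
      · exact ih m hm
      · exact lt_of_le_of_ne (h.value_nonpos hrec hsf ih) (h_never m ih)
  have h_anti : StrictAnti g := strictAnti_nat_of_succ_lt fun n => by
    rw [h.step_g n (h_all n)]
    exact add_lt_of_neg_right _ (h_all (n + 1) n n.lt_succ_self)
  -- `g n` is the average cost of `d n`, so a repeated rule would repeat a value of the strictly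
  -- decreasing `g`.
  have h_inj : Function.Injective d := fun m n hmn => h_anti.injective <| by
    rw [← h.avgCost_eq hrec hsf (h_all m) T.root, hmn, h.avgCost_eq hrec hsf (h_all n)]
  exact not_injective_infinite_finite d h_inj

end IsRun

end MDP

end SkipFreeMDP

theorem theorem1 {S A : Type*} [Fintype S] [Fintype A] [Nonempty A]
    (M : SkipFreeMDP.MDP S A) (T : SkipFreeMDP.RootedGraphTree S)
    (hrec : M.IsRecurrent) (hsf : M.IsSkipFree T) :
    -- the algorithm can be run from every initial policy
    (∀ d₀ : S → A, ∃ (d : ℕ → S → A) (g u : ℕ → ℝ) (y t : ℕ → S → ℝ),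
      d 0 = d₀ ∧ M.IsRun T d g u y t) ∧
    -- and every run has the following properties
    ∀ (d : ℕ → S → A) (g u : ℕ → ℝ) (y t : ℕ → S → ℝ), M.IsRun T d g u y t →
      -- (i) at each iteration that is carried out
      (∀ n, SkipFreeMDP.Performed u n →
        (∀ i, M.avgCost (.stationary (d n)) i = g n) ∧
        (∀ i, M.avgCost (.stationary (d (n + 1))) i = g (n + 1)) ∧
        (g (n + 1) < g n ∨
          (g (n + 1) = g n ∧
            M.IsOptimalCost (g (n + 1)) ∧
            M.IsOptimal (.stationary (d (n + 1))) ∧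
            ∀ h : S → ℝ, (M.SolvesOptimalityEq (g (n + 1)) h ∧ h T.root = 0) ↔
              h = fun j => ∑ k ∈ T.pathAfter T.root j, y (n + 1) k))) ∧
      -- (ii) the algorithm stops after finitely many iterations
      ∃ n, SkipFreeMDP.Performed u n ∧ u (n + 1) = 0 := by
  refine ⟨SkipFreeMDP.MDP.exists_isRun M T, fun d g u y t h =>
    ⟨fun n hn => ⟨h.avgCost_eq hrec hsf hn, h.avgCost_succ_eq hrec hsf hn, ?_⟩,
      h.exists_value_eq_zero hrec hsf⟩⟩
  rcases (h.value_nonpos hrec hsf hn).lt_or_eq with hu | hu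
  · left
    rw [h.step_g n hn]
    exact add_lt_of_neg_right _ hu
  right
  have hg : g (n + 1) = g n := by rw [h.step_g n hn, hu, add_zero]
  have h_sweep := h.step n hn
  rw [hu] at h_sweep
  have h_opt := h_sweep.solvesOptimalityEq hrec hsf
  rw [← hg] at h_opt
  have h_avg := h.avgCost_succ_eq hrec hsf hn
  refine ⟨hg, fun i => ⟨?_, fun b hb => ?_⟩, fun i π => ?_, fun h' => ⟨fun hh' => ?_, ?_⟩⟩
  · rintro _ ⟨π, rfl⟩
    exact h_opt.le_avgCost π i
  -- The infimum is attained by the rule `d (n + 1)`.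
  · exact h_avg i ▸ hb ⟨_, rfl⟩
  · rw [h_avg]
    exact h_opt.le_avgCost π i
  · funext j
    have h_sub := hh'.1.sub_eq_sub hrec h_opt j T.root
    rw [hh'.2, T.potential_root, sub_zero] at h_sub
    exact sub_eq_zero.1 h_sub
  · rintro rfl
    exact ⟨h_opt, T.potential_root _⟩
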